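/- Let $p>2$ be a prime. A growth function is an increasing function $\mathbb{R}^+\to\mathbb{R}^+$, and $\rho\ge\rho_0$ means $\rho(x)\ge\rho_0(x)$ for all $x\in\mathbb{R}^+$. A quadratic factor $\mathcal{B}=(\mathcal{L},\mathcal{Q})$ on $\mathbb{F}_p^n$ of complexity $(\ell,q)$ consists of linearly independent vectors $r_1,\dots,r_\ell\in\mathbb{F}_p^n$ and symmetric $n\times n$ matrices $M_1,\dots,M_q$ over $\mathbb{F}_p$; its rank is the minimum of $\mathrm{rk}(\lambda_1M_1+\dots+\lambda_qM_q)$ over all $(\lambda_1,\dots,\lambda_q)\in\mathbb{F}_p^q\setminus\{0\}$ (and $\infty$ if $q=0$). For $a=(u,v)\in\mathbb{F}_p^\ell\times\mathbb{F}_p^q=\mathbb{F}_p^{\ell+q}$ and $b\in\mathbb{F}_p^q$ let $$B(a)=\{x\in\mathbb{F}_p^n: x^Tr_i=u_i\ (1\le i\le\ell),\ x^TM_jx=v_j\ (1\le j\le q)\},$$ $$\beta(b)=\{(x,y)\in\mathbb{F}_p^n\times\mathbb{F}_p^n: x^TM_jy=b_j\ (1\le j\le q)\},\qquad \mu_{\beta(b)}=\frac{p^{2n}}{|\beta(b)|}1_{\beta(b)}.$$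 For $d=(a_1,a_2,a_3,b_{12},b_{13},b_{23})\in(\mathbb{F}_p^{\ell+q})^3\times(\mathbb{F}_p^q)^3$ let $\Sigma(d)=a_1+a_2+a_3+2(0,b_{12})+2(0,b_{13})+2(0,b_{23})\in\mathbb{F}_p^{\ell+q}$, and for $f:\mathbb{F}_p^n\to\mathbb{C}$ define the local semi-norm $\|f\|_{U^3(d)}\ge 0$ by $$\|f\|_{U^3(d)}^8=\mathbb{E}_{x_0,x_1\in B(a_1)}\mathbb{E}_{y_0,y_1\in B(a_2)}\mathbb{E}_{z_0,z_1\in B(a_3)}\prod_{i,j\in\{0,1\}}\mu_{\beta(b_{12})}(x_i,y_j)\prod_{i,k\in\{0,1\}}\mu_{\beta(b_{13})}(x_i,z_k)\prod_{j,k\in\{0,1\}}\mu_{\beta(b_{23})}(y_j,z_k)\prod_{\omega\in\{0,1\}^3}\mathcal{C}^{|\omega|}f(x_{\omega(1)}+y_{\omega(2)}+z_{\omega(3)}),$$ where $\mathbb{E}$ denotes the average over the indicated set, $\mathcal{C}$ is complex conjugation and $|\omega|$ is the number of ones in $\omega$. **Proposition (Locally sparse implies locally uniform).** For every $\varepsilon>0$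 there exists a growth function $\rho_0=\rho_0(\varepsilon)$ such that for any growth function $\rho\ge\rho_0$ the following holds. Let $\mathcal{B}=(\mathcal{L},\mathcal{Q})$ be a quadratic factor on $\mathbb{F}_p^n$ of complexity $(\ell,q)$ and rank at least $\rho(\ell+q)$, let $d=(a_1,a_2,a_3,b_{12},b_{13},b_{23})\in(\mathbb{F}_p^{\ell+q})^3\times(\mathbb{F}_p^q)^3$, let $A\subseteq\mathbb{F}_p^n$, and let $\alpha=|A\cap B(\Sigma(d))|/|B(\Sigma(d))|$ be the density of $A$ on the atom $B(\Sigma(d))$. If $\alpha\le\varepsilon$, then $$\|1_A-\alpha\|_{U^3(d)}\le 2\varepsilon^{1/8}.$$ -/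

import Mathlib

open scoped BigOperators ENNReal

namespace QuadFourier

/-- Growth functions: increasing functions `ℝ⁺ → ℝ⁺`. Only the values on positive reals matter. -/
def IsGrowthFunction (σ : ℝ → ℝ) : Prop :=
  (∀ x, 0 < x → 0 < σ x) ∧ MonotoneOn σ (Set.Ioi 0)

/-- A quadratic factor on `𝔽_p^n` of complexity `(ℓ, q)`: linearly independent vectors
`r_1, …, r_ℓ` together with symmetric `n × n` matrices `M_1, …, M_q`. -/
structure QuadraticFactor (p n ℓ q : ℕ) where
  r : Fin ℓ → Fin n → ZMod p
  M : Fin q → Matrix (Fin n) (Fin n) (ZMod p)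
  linearIndependent : LinearIndependent (ZMod p) r
  isSymm : ∀ j, (M j).IsSymm

/-- Labels of atoms, `𝔽_p^{ℓ+q} = 𝔽_p^ℓ × 𝔽_p^q`. -/
abbrev AtomLabel (p ℓ q : ℕ) : Type := (Fin ℓ → ZMod p) × (Fin q → ZMod p)

/-- Tuples `d = (a₁, a₂, a₃, b₁₂, b₁₃, b₂₃)`. -/
structure TripleLabel (p ℓ q : ℕ) where
  a₁ : AtomLabel p ℓ q
  a₂ : AtomLabel p ℓ q
  a₃ : AtomLabel p ℓ q
  b₁₂ : Fin q → ZMod p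
  b₁₃ : Fin q → ZMod p
  b₂₃ : Fin q → ZMod p

/-- `Σ(d) = a₁ + a₂ + a₃ + 2 (0 b₁₂) + 2 (0 b₁₃) + 2 (0 b₂₃)`. -/
def TripleLabel.sigma {p ℓ q : ℕ} (d : TripleLabel p ℓ q) : AtomLabel p ℓ q :=
  d.a₁ + d.a₂ + d.a₃ + (0, 2 • d.b₁₂) + (0, 2 • d.b₁₃) + (0, 2 • d.b₂₃)

/-- The normalised indicator (characteristic measure) `μ_β = 1_β · |V|² / |β|` of a set of
pairs `β ⊆ V × V`. -/
noncomputable def charMeasure {V : Type*} [Fintype V] [DecidableEq V]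
    (β : Finset (V × V)) (x y : V) : ℝ :=
  if (x, y) ∈ β then (Fintype.card V : ℝ) ^ 2 / (β.card : ℝ) else 0

/-- The density `|A ∩ B| / |B|` of `A` on `B`. -/
noncomputable def density {V : Type*} [DecidableEq V] (A B : Finset V) : ℝ :=
  ((A ∩ B).card : ℝ) / (B.card : ℝ)

namespace QuadraticFactor

variable {p n ℓ q : ℕ}

/-- The rank of a factor: the minimum of `rk (c₁ M₁ + ⋯ + c_q M_q)` over all nonzero `c ∈ 𝔽_p^q`.
If `q = 0` the minimum is over the empty set and equals `⊤`. -/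
noncomputable def rank (𝓑 : QuadraticFactor p n ℓ q) : ℕ∞ :=
  ⨅ (c : Fin q → ZMod p) (_ : c ≠ 0), ((∑ j, c j • 𝓑.M j).rank : ℕ∞)

variable [Fact p.Prime]

/-- The atom `B(a)`, for `a = (u, v)`: all `x` with `xᵀ r_i = u_i` and `xᵀ M_j x = v_j`. -/
def atom (𝓑 : QuadraticFactor p n ℓ q) (a : AtomLabel p ℓ q) : Finset (Fin n → ZMod p) :=
  {x | (∀ i, x ⬝ᵥ 𝓑.r i = a.1 i) ∧ ∀ j, x ⬝ᵥ (𝓑.M j).mulVec x = a.2 j}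

/-- The bilinear level set `β(b)`: all pairs `(x, y)` with `xᵀ M_j y = b_j` for every `j`. -/
def bilinearLevelSet (𝓑 : QuadraticFactor p n ℓ q) (b : Fin q → ZMod p) :
    Finset ((Fin n → ZMod p) × (Fin n → ZMod p)) :=
  {w | ∀ j, w.1 ⬝ᵥ (𝓑.M j).mulVec w.2 = b j}

/-- The local `U³(d)` inner product of a family `(f_ω)`, `ω ∈ {0,1}³`. The pairs `(x₀, x₁)`,
`(y₀, y₁)`, `(z₀, z₁)` are written as functions on `Fin 2`, and `|ω| = ω₀ + ω₁ + ω₂` is the number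
of ones in `ω`; complex conjugation is applied `|ω|` times. -/
noncomputable def localU3Inner (𝓑 : QuadraticFactor p n ℓ q) (d : TripleLabel p ℓ q)
    (f : (Fin 3 → Fin 2) → (Fin n → ZMod p) → ℂ) : ℂ :=
  𝔼 x ∈ Fintype.piFinset (fun _ : Fin 2 => 𝓑.atom d.a₁),
  𝔼 y ∈ Fintype.piFinset (fun _ : Fin 2 => 𝓑.atom d.a₂),
  𝔼 z ∈ Fintype.piFinset (fun _ : Fin 2 => 𝓑.atom d.a₃),
    (∏ i, ∏ j, (charMeasure (𝓑.bilinearLevelSet d.b₁₂) (x i) (y j) : ℂ)) *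
    (∏ i, ∏ k, (charMeasure (𝓑.bilinearLevelSet d.b₁₃) (x i) (z k) : ℂ)) *
    (∏ j, ∏ k, (charMeasure (𝓑.bilinearLevelSet d.b₂₃) (y j) (z k) : ℂ)) *
    ∏ ω : Fin 3 → Fin 2,
      (starRingEnd ℂ)^[∑ i, (ω i : ℕ)] (f ω (x (ω 0) + y (ω 1) + z (ω 2)))

/-- The local `U³(d)` semi-norm `⟨f, …, f⟩^{1/8}`. The inner product of eight copies of the same
function is a nonnegative real number, so it coincides with its modulus. -/
noncomputable def localU3Norm (𝓑 : QuadraticFactor p n ℓ q) (d : TripleLabel p ℓ q)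
    (f : (Fin n → ZMod p) → ℂ) : ℝ :=
  ‖𝓑.localU3Inner d (fun _ => f)‖ ^ (1 / 8 : ℝ)

end QuadraticFactor

end QuadFourier

namespace QuadFourier

/-! ### Exponential sums and equidistribution of quadratic systems -/

section Counting

variable {p : ℕ} [Fact p.Prime] {W : Type*} [AddCommGroup W] [Module (ZMod p) W] [Fintype W]

/-! Write `f = 1_A - α`. Since `|f| ≤ 1`, taking absolute values in the `U³(d)` inner product and
discarding every factor except `ω = 0` leaves a weighted sum of `|f(x₀ + y₀ + z₀)|` over the
configurations supporting the weights. The constraints force `x₀ + y₀ + z₀` into the atom `B(Σ(d))`,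
and there `|f|` has average at most `2α ≤ 2ε`. So it suffices that no point `w` of this atom is the
sum of too many configurations.

Fix `w` and eliminate `z₀ = w - x₀ - y₀`. The remaining conditions on `(x₀, y₀, x₁, y₁, z₁)` form a
system with one quadratic equation per matrix for each of the 15 unordered pairs of variables
(repetition allowed), together with `5ℓ + 2q` linear ones. High rank makes every nontrivial
exponential sum of the system small, by the Gauss sum bound `norm_sum_stdAddChar_quadratic_le`,
provided the linear equations are independent. This holds for generic `w`, and the fibre is then at
most about `p^(5n - 5ℓ - 17q)` (`card_configurations_fiber_le_of_isGeneric`). Non-generic `w` are so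
rare (`card_not_isGeneric_mul_le`) that the trivial fibre bound `p^(5n)` suffices for them.

The same counting gives the sizes of atoms and bilinear level sets. All powers of `p^ℓ` and `p^q`
then cancel, leaving a constant multiple of `ε`; any constant up to `2^8 = 256` gives the factor 2
after the eighth root. -/

theorem sum_stdAddChar_linearMap (L : W →ₗ[ZMod p] ZMod p) [Decidable (L = 0)] :
    ∑ v, ZMod.stdAddChar (L v) = if L = 0 then (Fintype.card W : ℂ) else 0 := by
  classical
  have h := AddChar.sum_eq_ite
    ((ZMod.stdAddChar (N := p)).compAddMonoidHom L.toAddMonoidHom)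
  have h0 : (ZMod.stdAddChar (N := p)).compAddMonoidHom L.toAddMonoidHom = 0 ↔ L = 0 := by
    constructor
    · intro h
      ext v
      have hv := DFunLike.congr_fun h v
      apply ZMod.injective_stdAddChar (N := p)
      simpa using hv
    · rintro rfl
      ext v
      simp
  simp only [h0] at h
  simpa using h

theorem sum_stdAddChar_dotProduct {K : Type*} [Fintype K] [DecidableEq K] (a : K → ZMod p) [Decidable (a = 0)] :
    ∑ c : K → ZMod p, ZMod.stdAddChar (∑ k, c k * a k) =
      if a = 0 then (p : ℂ) ^ Fintype.card K else 0 := by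
  classical
  let L : (K → ZMod p) →ₗ[ZMod p] ZMod p := Fintype.linearCombination (ZMod p) a
  have hL : L = 0 ↔ a = 0 := by
    constructor
    · intro h
      ext k
      simpa [L, Fintype.linearCombination_apply, Pi.single_apply] using
        DFunLike.congr_fun h (Pi.single k 1 : K → ZMod p)
    · intro h
      ext k
      simp [L, Fintype.linearCombination_apply, h]
  have := sum_stdAddChar_linearMap L
  simpa [hL, L, Fintype.linearCombination_apply, ZMod.card] using this

/-- If all nontrivial exponential sums of a family of functions are small, then its values are
nearly equidistributed. -/
theorem abs_density_sub_le_of_norm_sum_le {W K : Type*} [Fintype W] [Fintype K] [Nonempty W]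
    (Φ : K → W → ZMod p) {δ : ℝ}
    (hΦ : ∀ c : K → ZMod p, c ≠ 0 →
      ‖∑ v, ZMod.stdAddChar (∑ k, c k * Φ k v)‖ ≤ δ * Fintype.card W)
    (hδ : 0 ≤ δ) (u : K → ZMod p) (S : Finset W) (hS : ∀ v, v ∈ S ↔ ∀ k, Φ k v = u k) :
    |(S.card : ℝ) / Fintype.card W - ((p : ℝ) ^ Fintype.card K)⁻¹| ≤ δ := by
  classical
  have hp : (0 : ℝ) < p := by exact_mod_cast (Fact.out : p.Prime).pos
  have hW : (0 : ℝ) < Fintype.card W := by exact_mod_cast Fintype.card_pos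
  set P : ℝ := (p : ℝ) ^ Fintype.card K with hP
  have hP0 : 0 < P := by positivity
  -- Fourier expansion of the indicator of `S`: the frequency `c = 0` is the main term, and every
  -- other one is bounded by `hΦ`.
  set E : (K → ZMod p) → ℂ :=
    fun c => ZMod.stdAddChar (-∑ k, c k * u k) * ∑ v, ZMod.stdAddChar (∑ k, c k * Φ k v) with hE
  have hcount : (P : ℂ) * S.card = ∑ c, E c := by
    have h1 : ∀ v, ∑ c : K → ZMod p, ZMod.stdAddChar (∑ k, c k * (Φ k v - u k)) =
        if v ∈ S then (P : ℂ) else 0 := by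
      intro v
      rw [sum_stdAddChar_dotProduct (fun k => Φ k v - u k)]
      have : (fun k => Φ k v - u k) = 0 ↔ v ∈ S := by
        rw [hS, funext_iff]; simp [sub_eq_zero]
      simp only [this]
      simp [hP]
    calc (P : ℂ) * S.card = ∑ v, if v ∈ S then (P : ℂ) else 0 := by
          simp [Finset.sum_ite_mem, mul_comm]
      _ = ∑ v, ∑ c : K → ZMod p, ZMod.stdAddChar (∑ k, c k * (Φ k v - u k)) := by
          simp only [h1]
      _ = ∑ c, E c := by
          rw [Finset.sum_comm]
          refine Finset.sum_congr rfl fun c _ => ?_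
          simp only [hE, Finset.mul_sum]
          refine Finset.sum_congr rfl fun v _ => ?_
          rw [← AddChar.map_add_eq_mul]
          congr 1
          simp only [mul_sub, Finset.sum_sub_distrib]
          ring
  have hE0 : E 0 = Fintype.card W := by simp [hE]
  have hEc : ∀ c ∈ Finset.univ.erase (0 : K → ZMod p), ‖E c‖ ≤ δ * Fintype.card W := by
    intro c hc
    rw [hE]
    simp only [norm_mul, AddChar.norm_apply, one_mul]
    exact hΦ c (Finset.ne_of_mem_erase hc)
  have hbound : |P * S.card - Fintype.card W| ≤ P * (δ * Fintype.card W) := by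
    have h2 : ((P * S.card - Fintype.card W : ℝ) : ℂ) =
        ∑ c ∈ Finset.univ.erase (0 : K → ZMod p), E c := by
      push_cast
      rw [hcount, ← Finset.add_sum_erase _ _ (Finset.mem_univ (0 : K → ZMod p)), hE0]
      ring
    rw [← Real.norm_eq_abs, ← Complex.norm_real, h2]
    refine (norm_sum_le_of_le _ hEc).trans ?_
    rw [Finset.sum_const, nsmul_eq_mul]
    refine mul_le_mul_of_nonneg_right ?_ (by positivity)
    have : (Finset.univ.erase (0 : K → ZMod p)).card ≤ p ^ Fintype.card K := by
      refine (Finset.card_le_card (Finset.erase_subset _ _)).trans ?_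
      simp [ZMod.card]
    rw [hP]
    exact_mod_cast this
  have h3 : (S.card : ℝ) / Fintype.card W - P⁻¹ =
      (P * S.card - Fintype.card W) / (P * Fintype.card W) := by
    field_simp
  rw [h3, abs_div, abs_of_pos (by positivity : 0 < P * (Fintype.card W : ℝ)),
    div_le_iff₀ (by positivity)]
  linarith

theorem card_ker_mul_pow_le {X : Type*} [AddCommGroup X] [Module (ZMod p) X]
    (T : W →ₗ[ZMod p] X) {r : ℕ} (hr : r ≤ Module.finrank (ZMod p) (LinearMap.range T)) :
    Nat.card (LinearMap.ker T) * p ^ r ≤ Fintype.card W := by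
  have : Module.Finite (ZMod p) W := Module.Finite.of_finite
  have h1 := LinearMap.finrank_range_add_finrank_ker T
  rw [Module.natCard_eq_pow_finrank (K := ZMod p), ← Nat.card_eq_fintype_card,
    Module.natCard_eq_pow_finrank (K := ZMod p) (V := W), Nat.card_zmod, ← pow_add]
  exact Nat.pow_le_pow_right (Fact.out : p.Prime).pos (by omega)

/-- The Gauss sum of a quadratic phase is small if its polar form has large rank. -/
theorem norm_sum_stdAddChar_quadratic_le (B : W →ₗ[ZMod p] W →ₗ[ZMod p] ZMod p)
    (L : W →ₗ[ZMod p] ZMod p) {m : ℕ}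
    (hm : 2 * m ≤ Module.finrank (ZMod p) (LinearMap.range (B + B.flip))) :
    ‖∑ v, ZMod.stdAddChar (B v v + L v)‖ ≤ ((p : ℝ) ^ m)⁻¹ * Fintype.card W := by
  classical
  have hp : (0 : ℝ) < p := by exact_mod_cast (Fact.out : p.Prime).pos
  set D := B + B.flip with hD
  set φ : W → ZMod p := fun v => B v v + L v with hφ
  set s : ℂ := ∑ v, ZMod.stdAddChar (φ v) with hs
  -- Weyl differencing: `φ (v + h) - φ v = φ h + D h v`, linear in `v`, so only `h` in the kernel of
  -- `D` survives. Passing from `‖s‖ ^ 2` to `‖s‖` halves the exponent, whence `2 * m` in the rank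
  -- hypothesis.
  have hsq : s * (starRingEnd ℂ) s =
      ∑ h, ZMod.stdAddChar (φ h) * ∑ v, ZMod.stdAddChar (D h v) := by
    have h1 : (starRingEnd ℂ) s = ∑ v, ZMod.stdAddChar (-φ v) := by
      rw [hs, map_sum]
      exact Finset.sum_congr rfl fun v _ => (AddChar.map_neg_eq_conj _ _).symm
    calc s * (starRingEnd ℂ) s
        = ∑ v, ∑ h, ZMod.stdAddChar (φ (v + h)) * ZMod.stdAddChar (-φ v) := by
          rw [h1, Finset.mul_sum]
          refine Finset.sum_congr rfl fun v _ => ?_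
          rw [← Finset.sum_mul]
          congr 1
          exact (Equiv.sum_comp (Equiv.addLeft v) fun h => ZMod.stdAddChar (φ h)).symm
      _ = ∑ h, ∑ v, ZMod.stdAddChar (φ (v + h)) * ZMod.stdAddChar (-φ v) := Finset.sum_comm
      _ = _ := by
          refine Finset.sum_congr rfl fun h _ => ?_
          rw [Finset.mul_sum]
          refine Finset.sum_congr rfl fun v _ => ?_
          rw [← AddChar.map_add_eq_mul, ← AddChar.map_add_eq_mul]
          congr 1
          simp only [hφ, hD, map_add, LinearMap.add_apply, LinearMap.flip_apply]
          ring
  have hker : ‖s‖ ^ 2 ≤ Nat.card (LinearMap.ker D) * Fintype.card W := by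
    have h2 : ‖s‖ ^ 2 = ‖s * (starRingEnd ℂ) s‖ := by
      rw [norm_mul, RCLike.norm_conj, sq]
    rw [h2, hsq]
    have h3 : ∀ h ∈ (Finset.univ : Finset W),
        ‖ZMod.stdAddChar (φ h) * ∑ v, ZMod.stdAddChar (D h v)‖ ≤
          if h ∈ LinearMap.ker D then (Fintype.card W : ℝ) else 0 := by
      intro h _
      rw [norm_mul, AddChar.norm_apply, one_mul, sum_stdAddChar_linearMap (D h),
        LinearMap.mem_ker]
      split_ifs <;> simp
    refine (norm_sum_le_of_le _ h3).trans (le_of_eq ?_)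
    rw [← Finset.sum_filter, Finset.sum_const, nsmul_eq_mul]
    congr 2
    rw [Nat.card_eq_fintype_card, Fintype.card_subtype]
  have hcard : (Nat.card (LinearMap.ker D) : ℝ) * p ^ (2 * m) ≤ Fintype.card W := by
    exact_mod_cast card_ker_mul_pow_le D hm
  have hpm : (0 : ℝ) < p ^ m := by positivity
  refine (sq_le_sq₀ (norm_nonneg _) (by positivity)).1 ?_
  rw [inv_mul_eq_div, div_pow, le_div_iff₀ (by positivity), ← pow_mul, mul_comm m 2]
  calc ‖s‖ ^ 2 * (p : ℝ) ^ (2 * m)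
      ≤ (Nat.card (LinearMap.ker D) * Fintype.card W) * (p : ℝ) ^ (2 * m) := by gcongr
    _ = (Nat.card (LinearMap.ker D) * (p : ℝ) ^ (2 * m)) * Fintype.card W := by ring
    _ ≤ Fintype.card W * Fintype.card W := by gcongr
    _ = (Fintype.card W : ℝ) ^ 2 := by ring

/-- Counting the solutions of a system of quadratic and linear equations, when every nontrivial
combination of the quadratic ones has large rank. -/
theorem abs_density_quadratic_system_sub_le {J I : Type*} [Fintype J] [Fintype I]
    (B : J → W →ₗ[ZMod p] W →ₗ[ZMod p] ZMod p) (L : J → W →ₗ[ZMod p] ZMod p)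
    (T : I → W →ₗ[ZMod p] ZMod p) {m : ℕ}
    (hB : ∀ c : J → ZMod p, c ≠ 0 → 2 * m ≤ Module.finrank (ZMod p)
      (LinearMap.range ((∑ j, c j • B j) + (∑ j, c j • B j).flip)))
    (hT : LinearIndependent (ZMod p) T) (u : J → ZMod p) (t : I → ZMod p)
    (S : Finset W) (hS : ∀ v, v ∈ S ↔ (∀ j, B j v v + L j v = u j) ∧ ∀ i, T i v = t i) :
    |(S.card : ℝ) / Fintype.card W - ((p : ℝ) ^ (Fintype.card J + Fintype.card I))⁻¹| ≤
      ((p : ℝ) ^ m)⁻¹ := by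
  classical
  have key := abs_density_sub_le_of_norm_sum_le (K := J ⊕ I)
    (Sum.elim (fun j v => B j v v + L j v) fun i v => T i v) (δ := ((p : ℝ) ^ m)⁻¹) ?_
    (by positivity) (Sum.elim u t) S ?_
  · simpa using key
  · intro c hc
    have hsum : ∀ v, ∑ k, c k * (Sum.elim (fun j v => B j v v + L j v) (fun i v => T i v) :
        J ⊕ I → W → ZMod p) k v =
        (∑ j, c (Sum.inl j) • B j) v v +
          (∑ j, c (Sum.inl j) • L j + ∑ i, c (Sum.inr i) • T i) v := by
      intro v
      simp [Fintype.sum_sum_type, mul_add, Finset.sum_add_distrib, add_assoc]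
    simp only [hsum]
    -- Without a quadratic part the phase is a nonzero linear form, by independence of `T`, and the
    -- sum vanishes exactly.
    by_cases h : (fun j => c (Sum.inl j)) = 0
    · have h' : ∀ j, c (Sum.inl j) = 0 := fun j => congr_fun h j
      simp only [h', zero_smul, Finset.sum_const_zero, LinearMap.zero_apply, zero_add]
      rw [sum_stdAddChar_linearMap, if_neg]
      · simp only [norm_zero]; positivity
      · intro h0
        have := Fintype.linearIndependent_iff.1 hT _ h0
        exact hc (funext fun k => Sum.rec h' this k)
    · exact norm_sum_stdAddChar_quadratic_le _ _ (hB _ h)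
  · intro v
    rw [hS]
    simp

end Counting

/-! ### Systems built from the forms `v_sᵀ M_j v_t` in several vector variables -/

section CoordForm

variable {p : ℕ} [Fact p.Prime] {n : ℕ} {κ : Type*}

/-- The bilinear form `(v, v') ↦ v_sᵀ M v'_t` on `(𝔽_p^n)^κ`. -/
noncomputable def coordForm (M : Matrix (Fin n) (Fin n) (ZMod p)) (s t : κ) :
    (κ → Fin n → ZMod p) →ₗ[ZMod p] (κ → Fin n → ZMod p) →ₗ[ZMod p] ZMod p :=
  (Matrix.toLinearMap₂' (ZMod p) M).compl₁₂ (LinearMap.proj s) (LinearMap.proj t)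

@[simp] theorem coordForm_apply (M : Matrix (Fin n) (Fin n) (ZMod p)) (s t : κ)
    (v w : κ → Fin n → ZMod p) : coordForm M s t v w = v s ⬝ᵥ M.mulVec (w t) := by
  simp [coordForm, Matrix.toLinearMap₂'_apply']

/-- The linear form `v ↦ v_s · r` on `(𝔽_p^n)^κ`. -/
noncomputable def coordFunctional (r : Fin n → ZMod p) (s : κ) :
    (κ → Fin n → ZMod p) →ₗ[ZMod p] ZMod p :=
  (dotProductBilin (ZMod p) (ZMod p)).flip r ∘ₗ LinearMap.proj s

@[simp] theorem coordFunctional_apply (r : Fin n → ZMod p) (s : κ) (v : κ → Fin n → ZMod p) :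
    coordFunctional r s v = v s ⬝ᵥ r := by
  simp [coordFunctional]

/-- Testing on vectors supported in a single coordinate separates the relation into one relation per
coordinate. -/
theorem linearIndependent_coordFunctional [DecidableEq κ] {I : Type*} [Fintype I] (σ : I → κ)
    (R : I → Fin n → ZMod p)
    (h : ∀ d : I → ZMod p, (∀ s, ∑ i, (if σ i = s then d i • R i else 0) = 0) → d = 0) :
    LinearIndependent (ZMod p) fun i => coordFunctional (R i) (σ i) := by
  rw [Fintype.linearIndependent_iff]
  intro d hd
  refine fun i => congr_fun (h d fun s => ?_) i
  refine dotProduct_eq_zero _ fun x => ?_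
  have := DFunLike.congr_fun hd (Pi.single s x)
  simp only [LinearMap.sum_apply, LinearMap.smul_apply, coordFunctional_apply,
    LinearMap.zero_apply] at this
  rw [sum_dotProduct, ← this]
  refine Finset.sum_congr rfl fun i _ => ?_
  by_cases hs : σ i = s
  · subst hs; simp [dotProduct_comm]
  · simp [hs]

/-- The rank of a form is at least that of any of its blocks. Choose a pair `(s, t)` carrying a
nonzero coefficient: the corresponding block of the polar form is `N = ∑ c'_j M_j`, or `2N` when `s
= t`, and `N` has rank at least `R`. Injectivity of `e` and the ordering of the pairs prevent other
pairs from contributing to this block. -/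
theorem rank_le_finrank_range_coordForm [Fintype κ] [LinearOrder κ] {P : Type*} [Fintype P] (hp : 2 < p)
    {q : ℕ} (M : Fin q → Matrix (Fin n) (Fin n) (ZMod p)) (hM : ∀ j, (M j).IsSymm) {R : ℕ}
    (hR : ∀ c : Fin q → ZMod p, c ≠ 0 → R ≤ (∑ j, c j • M j).rank)
    (e : P → κ × κ) (he : Function.Injective e) (hle : ∀ a, (e a).1 ≤ (e a).2)
    (c : P × Fin q → ZMod p) (hc : c ≠ 0) :
    R ≤ Module.finrank (ZMod p) (LinearMap.range
      ((∑ a, c a • coordForm (M a.2) (e a.1).1 (e a.1).2) +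
        (∑ a, c a • coordForm (M a.2) (e a.1).1 (e a.1).2).flip)) := by
  classical
  obtain ⟨⟨a₀, j₀⟩, ha₀⟩ : ∃ a, c a ≠ 0 := by
    by_contra! h
    exact hc (funext h)
  set B := ∑ a, c a • coordForm (M a.2) (e a.1).1 (e a.1).2 with hB
  set D := B + B.flip with hD
  set s := (e a₀).1 with hs
  set t := (e a₀).2 with ht
  set c' : Fin q → ZMod p := fun j => c (a₀, j) with hc'
  have hc'0 : c' ≠ 0 := fun h => ha₀ (congr_fun h j₀)
  set N := ∑ j, c' j • M j with hN
  have hNs : N.IsSymm := by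
    rw [Matrix.IsSymm, hN, Matrix.transpose_sum]
    exact Finset.sum_congr rfl fun j _ => by rw [Matrix.transpose_smul, (hM j).eq]
  set single : (r : κ) → (Fin n → ZMod p) →ₗ[ZMod p] (κ → Fin n → ZMod p) :=
    LinearMap.single (ZMod p) (fun _ => Fin n → ZMod p) with hsingle
  have hN' : ∀ h k : Fin n → ZMod p, ∑ j, c' j * (h ⬝ᵥ (M j).mulVec k) = h ⬝ᵥ N.mulVec k := by
    intro h k
    rw [hN, Matrix.sum_mulVec, dotProduct_sum]
    exact Finset.sum_congr rfl fun j _ => by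
      rw [Matrix.smul_mulVec, dotProduct_smul, smul_eq_mul]
  have hBst : ∀ h k, B (single s h) (single t k) = h ⬝ᵥ N.mulVec k := by
    intro h k
    rw [hB, ← hN', LinearMap.sum_apply, LinearMap.sum_apply, Fintype.sum_prod_type,
      Finset.sum_eq_single a₀]
    · simp [hsingle, hs, ht, hc']
    · intro a _ ha
      refine Finset.sum_eq_zero fun j _ => ?_
      have : ¬ ((e a).1 = s ∧ (e a).2 = t) := fun h => ha (he (Prod.ext h.1 h.2))
      by_cases h1 : (e a).1 = s
      · have h2 : (e a).2 ≠ t := fun h2 => this ⟨h1, h2⟩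
        simp [hsingle, Pi.single_apply, h2]
      · simp [hsingle, Pi.single_apply, h1]
    · simp
  have hBts : ∀ h k, B (single t k) (single s h) =
      if s = t then h ⬝ᵥ N.mulVec k else 0 := by
    intro h k
    split_ifs with hst
    · have := hBst k h
      rw [← hst] at this ⊢
      rw [this, Matrix.dotProduct_mulVec, ← Matrix.mulVec_transpose, hNs.eq, dotProduct_comm]
    · rw [hB, LinearMap.sum_apply, LinearMap.sum_apply]
      refine Finset.sum_eq_zero fun a _ => ?_
      -- A pair equal to `(t, s)` would give `t ≤ s`, hence `s = t` because also `s ≤ t`.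
      by_cases h1 : (e a.1).1 = t
      · have h2 : (e a.1).2 ≠ s := by
          intro h2
          have h3 := hle a.1
          rw [h1, h2] at h3
          exact hst (le_antisymm (hle a₀) h3)
        simp [hsingle, Pi.single_apply, h2]
      · simp [hsingle, Pi.single_apply, h1]
  set T : (Fin n → ZMod p) →ₗ[ZMod p] ((Fin n → ZMod p) →ₗ[ZMod p] ZMod p) :=
    (single t).dualMap ∘ₗ D ∘ₗ single s with hT
  have hTapp : ∀ h k, T h k = (if s = t then 2 else 1) * (h ⬝ᵥ N.mulVec k) := by
    intro h k
    have : T h k = B (single s h) (single t k) + B (single t k) (single s h) := rfl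
    rw [this, hBst, hBts]
    split_ifs <;> ring
  -- Odd characteristic is needed for the diagonal block `2N`.
  have h2 : (2 : ZMod p) ≠ 0 := by
    intro h
    have : ((2 : ℕ) : ZMod p) = 0 := by exact_mod_cast h
    rw [ZMod.natCast_eq_zero_iff] at this
    exact absurd (Nat.le_of_dvd two_pos this) (by omega)
  have hker : LinearMap.ker T ≤ LinearMap.ker N.mulVecLin := by
    intro h hh
    rw [LinearMap.mem_ker] at hh ⊢
    rw [Matrix.mulVecLin_apply]
    refine dotProduct_eq_zero _ fun k => ?_
    have h3 := DFunLike.congr_fun hh k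
    rw [hTapp, LinearMap.zero_apply, mul_eq_zero, or_iff_right (by split_ifs <;> simp [h2])] at h3
    rwa [Matrix.dotProduct_mulVec, ← Matrix.mulVec_transpose, hNs.eq] at h3
  have hrank : N.rank ≤ Module.finrank (ZMod p) (LinearMap.range T) := by
    have h3 := LinearMap.finrank_range_add_finrank_ker T
    have h4 := LinearMap.finrank_range_add_finrank_ker N.mulVecLin
    have h5 := Submodule.finrank_mono hker
    rw [Matrix.rank]
    omega
  refine (hR c' hc'0).trans (hrank.trans ?_)
  rw [hT, LinearMap.range_comp]
  exact (Submodule.finrank_map_le _ _).trans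
    (Submodule.finrank_mono (LinearMap.range_comp_le_range _ _))

/-- Counting the solutions in `(𝔽_p^n)^κ` of a system whose quadratic parts are the forms
`v_sᵀ M_j v_t`. -/
theorem abs_density_coordForm_system_sub_le [Fintype κ] [LinearOrder κ] {P I : Type*}
    [Fintype P] [Fintype I] (hp : 2 < p)
    {q : ℕ} (M : Fin q → Matrix (Fin n) (Fin n) (ZMod p)) (hM : ∀ j, (M j).IsSymm) {m : ℕ}
    (hm : ∀ c : Fin q → ZMod p, c ≠ 0 → 2 * m ≤ (∑ j, c j • M j).rank)
    (e : P → κ × κ) (he : Function.Injective e) (hle : ∀ a, (e a).1 ≤ (e a).2)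
    (L : P × Fin q → (κ → Fin n → ZMod p) →ₗ[ZMod p] ZMod p)
    (T : I → (κ → Fin n → ZMod p) →ₗ[ZMod p] ZMod p) (hT : LinearIndependent (ZMod p) T)
    (u : P × Fin q → ZMod p) (t : I → ZMod p) (S : Finset (κ → Fin n → ZMod p))
    (hS : ∀ v, v ∈ S ↔
      (∀ a, v (e a.1).1 ⬝ᵥ (M a.2).mulVec (v (e a.1).2) + L a v = u a) ∧ ∀ i, T i v = t i) :
    |(S.card : ℝ) / ((p : ℝ) ^ n) ^ Fintype.card κ -
        ((p : ℝ) ^ (Fintype.card P * q + Fintype.card I))⁻¹| ≤ ((p : ℝ) ^ m)⁻¹ := by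
  have := abs_density_quadratic_system_sub_le
    (fun a : P × Fin q => coordForm (M a.2) (e a.1).1 (e a.1).2) L T (m := m)
    (fun c hc => rank_le_finrank_range_coordForm hp M hM hm e he hle c hc) hT u t S
    (by simpa using hS)
  simpa [ZMod.card] using this

end CoordForm

/-! ### Sizes of atoms and bilinear level sets -/

namespace QuadraticFactor

variable {p n ℓ q : ℕ} [Fact p.Prime]

theorem mem_atom (𝓑 : QuadraticFactor p n ℓ q) (a : AtomLabel p ℓ q) (x : Fin n → ZMod p) :
    x ∈ 𝓑.atom a ↔ (∀ i, x ⬝ᵥ 𝓑.r i = a.1 i) ∧ ∀ j, x ⬝ᵥ (𝓑.M j).mulVec x = a.2 j := by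
  simp [atom]

theorem mem_bilinearLevelSet (𝓑 : QuadraticFactor p n ℓ q) (b : Fin q → ZMod p)
    (x y : Fin n → ZMod p) :
    (x, y) ∈ 𝓑.bilinearLevelSet b ↔ ∀ j, x ⬝ᵥ (𝓑.M j).mulVec y = b j := by
  simp [bilinearLevelSet]

theorem abs_density_atom_sub_le (hp : 2 < p) (𝓑 : QuadraticFactor p n ℓ q) {m : ℕ}
    (hm : ∀ c : Fin q → ZMod p, c ≠ 0 → 2 * m ≤ (∑ j, c j • 𝓑.M j).rank)
    (a : AtomLabel p ℓ q) :
    |((𝓑.atom a).card : ℝ) / (p : ℝ) ^ n - ((p : ℝ) ^ (q + ℓ))⁻¹| ≤ ((p : ℝ) ^ m)⁻¹ := by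
  have := abs_density_coordForm_system_sub_le (κ := Fin 1) (P := Unit) (I := Fin ℓ) hp 𝓑.M
    𝓑.isSymm hm (fun _ => (0, 0)) (Function.injective_of_subsingleton _) (fun _ => le_rfl)
    (fun _ => 0) (fun i => coordFunctional (𝓑.r i) 0)
    (linearIndependent_coordFunctional (fun _ => 0) 𝓑.r fun d hd => funext
      (Fintype.linearIndependent_iff.1 𝓑.linearIndependent d (by simpa using hd 0)))
    (fun a' => a.2 a'.2) a.1
    ((𝓑.atom a).map (Equiv.funUnique (Fin 1) (Fin n → ZMod p)).symm.toEmbedding)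
    (fun v => by
      rw [Finset.mem_map_equiv, mem_atom]
      simp [and_comm])
  simpa using this

theorem abs_density_bilinearLevelSet_sub_le (hp : 2 < p) (𝓑 : QuadraticFactor p n ℓ q) {m : ℕ}
    (hm : ∀ c : Fin q → ZMod p, c ≠ 0 → 2 * m ≤ (∑ j, c j • 𝓑.M j).rank)
    (b : Fin q → ZMod p) :
    |((𝓑.bilinearLevelSet b).card : ℝ) / ((p : ℝ) ^ n) ^ 2 - ((p : ℝ) ^ q)⁻¹| ≤
      ((p : ℝ) ^ m)⁻¹ := by
  have := abs_density_coordForm_system_sub_le (κ := Fin 2) (P := Unit) (I := Empty) hp 𝓑.M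
    𝓑.isSymm hm (fun _ => (0, 1)) (Function.injective_of_subsingleton _) (fun _ => zero_le_one)
    (fun _ => 0) (fun i => i.elim) linearIndependent_empty_type
    (fun a' => b a'.2) (fun i => i.elim)
    ((𝓑.bilinearLevelSet b).map (finTwoArrowEquiv (Fin n → ZMod p)).symm.toEmbedding)
    (fun v => by
      rw [Finset.mem_map_equiv]
      simp [bilinearLevelSet])
  simpa using this

/-! ### Generic points -/

/-- The points `w` for which the vectors `M_j w` are linearly independent modulo the span of the
vectors `r_i`. -/
def IsGeneric (𝓑 : QuadraticFactor p n ℓ q) (w : Fin n → ZMod p) : Prop :=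
  ∀ (c : Fin q → ZMod p) (d : Fin ℓ → ZMod p),
    ∑ i, d i • 𝓑.r i + ∑ j, c j • (𝓑.M j).mulVec w = 0 → c = 0

theorem IsGeneric.eq_zero {𝓑 : QuadraticFactor p n ℓ q} {w : Fin n → ZMod p}
    (hw : 𝓑.IsGeneric w) {c : Fin q → ZMod p} {d : Fin ℓ → ZMod p}
    (h : ∑ i, d i • 𝓑.r i + ∑ j, c j • (𝓑.M j).mulVec w = 0) : c = 0 ∧ d = 0 := by
  have hc := hw c d h
  subst hc
  exact ⟨rfl, funext (Fintype.linearIndependent_iff.1 𝓑.linearIndependent d (by simpa using h))⟩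

-- For each of the at most `p ^ (q + ℓ)` pairs `(c, d)` with `c ≠ 0`, the offending `w` form a coset
-- of the kernel of `∑ c_j M_j` or the empty set; sum over the pairs.
open Classical in
theorem card_not_isGeneric_mul_le (𝓑 : QuadraticFactor p n ℓ q) {R : ℕ}
    (hR : ∀ c : Fin q → ZMod p, c ≠ 0 → R ≤ (∑ j, c j • 𝓑.M j).rank) :
    (Finset.univ.filter fun w => ¬ 𝓑.IsGeneric w).card * p ^ R ≤ p ^ (q + ℓ) * p ^ n := by
  set F : (Fin q → ZMod p) × (Fin ℓ → ZMod p) → Finset (Fin n → ZMod p) := fun cd =>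
    Finset.univ.filter fun w =>
      cd.1 ≠ 0 ∧ ∑ i, cd.2 i • 𝓑.r i + ∑ j, cd.1 j • (𝓑.M j).mulVec w = 0 with hF
  have hsub : (Finset.univ.filter fun w => ¬ 𝓑.IsGeneric w) ⊆ Finset.univ.biUnion F := by
    intro w hw
    simp only [Finset.mem_filter, Finset.mem_univ, true_and, IsGeneric, not_forall] at hw
    obtain ⟨c, d, h, hc⟩ := hw
    simp only [Finset.mem_biUnion, Finset.mem_univ, true_and]
    exact ⟨(c, d), by simp [hF, h, hc]⟩
  have hcard : ∀ cd, (F cd).card * p ^ R ≤ p ^ n := by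
    rintro ⟨c, d⟩
    by_cases hc : c = 0
    · simp [hF, hc]
    set N := ∑ j, c j • 𝓑.M j with hN
    have hNw : ∀ w, ∑ j, c j • (𝓑.M j).mulVec w = N.mulVecLin w := by
      intro w
      rw [Matrix.mulVecLin_apply, hN, Matrix.sum_mulVec]
      exact Finset.sum_congr rfl fun j _ => by rw [Matrix.smul_mulVec]
    have hle : (F (c, d)).card ≤ Nat.card (LinearMap.ker N.mulVecLin) := by
      rcases (F (c, d)).eq_empty_or_nonempty with h0 | ⟨w₀, hw₀⟩
      · simp [h0]
      have hmem : ∀ w ∈ F (c, d), w - w₀ ∈ LinearMap.ker N.mulVecLin := by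
        intro w hw
        simp only [hF, Finset.mem_filter, Finset.mem_univ, true_and, hNw] at hw hw₀
        rw [LinearMap.mem_ker, map_sub, sub_eq_zero]
        exact add_left_cancel (hw.2.trans hw₀.2.symm)
      rw [Nat.card_eq_fintype_card, Fintype.card_subtype]
      refine Finset.card_le_card_of_injOn (fun w => w - w₀) ?_ ?_
      · intro w hw
        simpa using hmem w hw
      · intro w _ w' _ h
        exact sub_left_injective h
    have h1 := card_ker_mul_pow_le N.mulVecLin (hR c hc)
    refine (Nat.mul_le_mul_right _ hle).trans (h1.trans ?_)
    simp [ZMod.card]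
  calc (Finset.univ.filter fun w => ¬ 𝓑.IsGeneric w).card * p ^ R
      ≤ (∑ cd, (F cd).card) * p ^ R :=
        Nat.mul_le_mul_right _ ((Finset.card_le_card hsub).trans Finset.card_biUnion_le)
    _ = ∑ cd, (F cd).card * p ^ R := Finset.sum_mul _ _ _
    _ ≤ ∑ _cd : (Fin q → ZMod p) × (Fin ℓ → ZMod p), p ^ n :=
        Finset.sum_le_sum fun cd _ => hcard cd
    _ = p ^ (q + ℓ) * p ^ n := by simp [ZMod.card, pow_add]

/-! ### Configurations with a prescribed sum -/

/-- The configurations `(x, y, z)` which carry the weight of the local `U³(d)` inner product. -/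
def configurations (𝓑 : QuadraticFactor p n ℓ q) (d : TripleLabel p ℓ q) :
    Finset ((Fin 2 → Fin n → ZMod p) × (Fin 2 → Fin n → ZMod p) × (Fin 2 → Fin n → ZMod p)) :=
  {v | ((∀ i, v.1 i ∈ 𝓑.atom d.a₁) ∧ (∀ i, v.2.1 i ∈ 𝓑.atom d.a₂) ∧
      ∀ i, v.2.2 i ∈ 𝓑.atom d.a₃) ∧
    (∀ i j, (v.1 i, v.2.1 j) ∈ 𝓑.bilinearLevelSet d.b₁₂) ∧
    (∀ i k, (v.1 i, v.2.2 k) ∈ 𝓑.bilinearLevelSet d.b₁₃) ∧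
    ∀ j k, (v.2.1 j, v.2.2 k) ∈ 𝓑.bilinearLevelSet d.b₂₃}

theorem dotProduct_mulVec_comm (𝓑 : QuadraticFactor p n ℓ q) (j : Fin q)
    (x y : Fin n → ZMod p) : x ⬝ᵥ (𝓑.M j).mulVec y = y ⬝ᵥ (𝓑.M j).mulVec x := by
  rw [Matrix.dotProduct_mulVec, ← Matrix.mulVec_transpose, (𝓑.isSymm j).eq, dotProduct_comm]

/-- Expand the quadratic form at `x + y + z`: by symmetry of `M_j` each cross term occurs twice,
which explains the factors 2 in `Σ(d)`. -/
theorem add_add_mem_atom_sigma (𝓑 : QuadraticFactor p n ℓ q) (d : TripleLabel p ℓ q)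
    {x y z : Fin n → ZMod p} (hx : x ∈ 𝓑.atom d.a₁) (hy : y ∈ 𝓑.atom d.a₂)
    (hz : z ∈ 𝓑.atom d.a₃) (hxy : (x, y) ∈ 𝓑.bilinearLevelSet d.b₁₂)
    (hxz : (x, z) ∈ 𝓑.bilinearLevelSet d.b₁₃) (hyz : (y, z) ∈ 𝓑.bilinearLevelSet d.b₂₃) :
    x + y + z ∈ 𝓑.atom d.sigma := by
  rw [mem_atom] at *
  rw [mem_bilinearLevelSet] at *
  refine ⟨fun i => ?_, fun j => ?_⟩
  · simp [TripleLabel.sigma, add_dotProduct, hx.1, hy.1, hz.1]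
  · have hyx := 𝓑.dotProduct_mulVec_comm j y x
    have hzx := 𝓑.dotProduct_mulVec_comm j z x
    have hzy := 𝓑.dotProduct_mulVec_comm j z y
    simp only [TripleLabel.sigma, add_dotProduct, Matrix.mulVec_add, dotProduct_add, hyx, hzx,
      hzy, hx.2, hy.2, hz.2, hxy j, hxz j, hyz j, Prod.snd_add, Pi.add_apply, two_smul]
    ring

/-- The configurations with `x₀ + y₀ + z₀ = w` as points of `(𝔽_p^n)^5`, the coordinates being
`x₀, y₀, x₁, y₁, z₁`. -/
theorem card_configurations_fiber_le (𝓑 : QuadraticFactor p n ℓ q) (d : TripleLabel p ℓ q)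
    (w : Fin n → ZMod p) (S : Finset (Fin 5 → Fin n → ZMod p))
    (hS : ∀ x y z, (x, y, z) ∈ 𝓑.configurations d → x 0 + y 0 + z 0 = w →
      ![x 0, y 0, x 1, y 1, z 1] ∈ S) :
    ((𝓑.configurations d).filter fun v => v.1 0 + v.2.1 0 + v.2.2 0 = w).card ≤ S.card := by
  refine Finset.card_le_card_of_injOn
    (fun v => ![v.1 0, v.2.1 0, v.1 1, v.2.1 1, v.2.2 1]) ?_ ?_
  · rintro ⟨x, y, z⟩ h
    simp only [Finset.coe_filter, Set.mem_ofPred_eq] at h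
    exact hS x y z h.1 h.2
  · rintro ⟨x, y, z⟩ h ⟨x', y', z'⟩ h' heq
    simp only [Finset.coe_filter, Set.mem_ofPred_eq] at h h'
    have e := fun i => congr_fun heq i
    have e0 := e 0
    have e1 := e 1
    have e2 := e 2
    have e3 := e 3
    have e4 := e 4
    simp at e0 e1 e2 e3 e4
    have e5 : z 0 = z' 0 := by
      have := h.2.trans h'.2.symm
      rw [e0, e1] at this
      exact add_left_cancel this
    simp only [Prod.mk.injEq, funext_iff (f := x), funext_iff (f := y), funext_iff (f := z),
      Fin.forall_fin_two]
    exact ⟨⟨e0, e2⟩, ⟨e1, e3⟩, e5, e4⟩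

theorem card_configurations_fiber_le_pow (𝓑 : QuadraticFactor p n ℓ q) (d : TripleLabel p ℓ q)
    (w : Fin n → ZMod p) :
    ((𝓑.configurations d).filter fun v => v.1 0 + v.2.1 0 + v.2.2 0 = w).card ≤
      (p ^ n) ^ 5 := by
  refine (𝓑.card_configurations_fiber_le d w Finset.univ fun _ _ _ _ _ =>
    Finset.mem_univ _).trans ?_
  simp [ZMod.card]

/-- Substitute `z₀ = w - x₀ - y₀`. The conditions on `(x₀, z₀)` and `(y₀, z₀)` become linear, `x₀ ·
M_j w` and `y₀ · M_j w` being prescribed; those on `(x₁, z₀)` and `(y₁, z₀)` become quadratic in the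
pairs `(x₀, x₁)` and `(y₀, y₁)`, with a linear correction. The atom condition on `z₀` is dropped, as
only an upper bound is needed. Genericity makes the linear conditions independent. -/
theorem card_configurations_fiber_le_of_isGeneric (hp : 2 < p) (𝓑 : QuadraticFactor p n ℓ q)
    {m : ℕ} (hm : ∀ c : Fin q → ZMod p, c ≠ 0 → 2 * m ≤ (∑ j, c j • 𝓑.M j).rank)
    (d : TripleLabel p ℓ q) {w : Fin n → ZMod p} (hw : 𝓑.IsGeneric w) :
    (((𝓑.configurations d).filter fun v => v.1 0 + v.2.1 0 + v.2.2 0 = w).card : ℝ) ≤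
      (((p : ℝ) ^ (5 * ℓ + 17 * q))⁻¹ + ((p : ℝ) ^ m)⁻¹) * ((p : ℝ) ^ n) ^ 5 := by
  classical
  let e : {a : Fin 5 × Fin 5 // a.1 ≤ a.2} → Fin 5 × Fin 5 := Subtype.val
  let L : {a : Fin 5 × Fin 5 // a.1 ≤ a.2} × Fin q →
      (Fin 5 → Fin n → ZMod p) →ₗ[ZMod p] ZMod p := fun a =>
    if e a.1 = (0, 2) then -coordFunctional ((𝓑.M a.2).mulVec w) 2
    else if e a.1 = (1, 3) then -coordFunctional ((𝓑.M a.2).mulVec w) 3 else 0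
  -- Right-hand sides for the pairs of variables in the order `x₀, y₀, x₁, y₁, z₁`. Entries `(0, 2)`
  -- and `(1, 3)` come from the conditions on `(x₁, z₀)` and `(y₁, z₀)`; entries below the diagonal
  -- are never used.
  let U : Fin 5 → Fin 5 → Fin q → ZMod p :=
    ![![d.a₁.2, d.b₁₂, -d.b₁₂ - d.b₁₃, d.b₁₂, d.b₁₃],
      ![0, d.a₂.2, d.b₁₂, -d.b₁₂ - d.b₂₃, d.b₂₃],
      ![0, 0, d.a₁.2, d.b₁₂, d.b₁₃],
      ![0, 0, 0, d.a₂.2, d.b₂₃],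
      ![0, 0, 0, 0, d.a₃.2]]
  let u : {a : Fin 5 × Fin 5 // a.1 ≤ a.2} × Fin q → ZMod p :=
    fun a => U (e a.1).1 (e a.1).2 a.2
  let σ : (Fin 5 × Fin ℓ) ⊕ (Fin q ⊕ Fin q) → Fin 5 :=
    Sum.elim Prod.fst (Sum.elim (fun _ => 0) fun _ => 1)
  let R : (Fin 5 × Fin ℓ) ⊕ (Fin q ⊕ Fin q) → Fin n → ZMod p :=
    Sum.elim (fun a => 𝓑.r a.2)
      (Sum.elim (fun j => (𝓑.M j).mulVec w) fun j => (𝓑.M j).mulVec w)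
  let t : (Fin 5 × Fin ℓ) ⊕ (Fin q ⊕ Fin q) → ZMod p :=
    Sum.elim (fun a => (![d.a₁.1, d.a₂.1, d.a₁.1, d.a₂.1, d.a₃.1] : Fin 5 → _) a.1 a.2)
      (Sum.elim (d.a₁.2 + d.b₁₂ + d.b₁₃) (d.b₁₂ + d.a₂.2 + d.b₂₃))
  have hT : LinearIndependent (ZMod p) fun i => coordFunctional (R i) (σ i) := by
    refine linearIndependent_coordFunctional σ R fun c hc => ?_
    simp only [Fintype.sum_sum_type, Fintype.sum_prod_type, σ, R, Sum.elim_inl,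
      Sum.elim_inr, Fin.sum_univ_five] at hc
    have h0 := hw.eq_zero (c := fun j => c (Sum.inr (Sum.inl j)))
      (d := fun i => c (Sum.inl (0, i))) (by simpa using hc 0)
    have h1 := hw.eq_zero (c := fun j => c (Sum.inr (Sum.inr j)))
      (d := fun i => c (Sum.inl (1, i))) (by simpa using hc 1)
    have h2 := hw.eq_zero (c := 0) (d := fun i => c (Sum.inl (2, i))) (by simpa using hc 2)
    have h3 := hw.eq_zero (c := 0) (d := fun i => c (Sum.inl (3, i))) (by simpa using hc 3)
    have h4 := hw.eq_zero (c := 0) (d := fun i => c (Sum.inl (4, i))) (by simpa using hc 4)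
    funext i
    rcases i with ⟨s, i⟩ | j | j
    · fin_cases s
      · exact congr_fun h0.2 i
      · exact congr_fun h1.2 i
      · exact congr_fun h2.2 i
      · exact congr_fun h3.2 i
      · exact congr_fun h4.2 i
    · exact congr_fun h0.1 j
    · exact congr_fun h1.1 j
  have hcount := abs_density_coordForm_system_sub_le (κ := Fin 5) hp 𝓑.M 𝓑.isSymm hm e
    Subtype.val_injective (fun a => a.2) L _ hT u t
    (Finset.univ.filter fun v =>
      (∀ a, v (e a.1).1 ⬝ᵥ (𝓑.M a.2).mulVec (v (e a.1).2) + L a v = u a) ∧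
        ∀ i, coordFunctional (R i) (σ i) v = t i)
    (fun v => by simp)
  have hle := 𝓑.card_configurations_fiber_le d w (Finset.univ.filter fun v =>
      (∀ a, v (e a.1).1 ⬝ᵥ (𝓑.M a.2).mulVec (v (e a.1).2) + L a v = u a) ∧
        ∀ i, coordFunctional (R i) (σ i) v = t i) ?_
  · have hP : Fintype.card {a : Fin 5 × Fin 5 // a.1 ≤ a.2} = 15 := by decide
    -- 15 quadratic conditions per matrix, `ℓ` linear ones per variable, and `2q` from `M_j w`
    -- paired with `x₀` and `y₀`.
    have hexp : 15 * q + (5 * ℓ + (q + q)) = 5 * ℓ + 17 * q := by ring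
    simp only [hP, Fintype.card_sum, Fintype.card_prod, Fintype.card_fin, hexp] at hcount
    have h1 := (abs_le.1 hcount).2
    have hp0 : (0 : ℝ) < p := by exact_mod_cast (Fact.out : p.Prime).pos
    rw [sub_le_iff_le_add, div_le_iff₀ (by positivity)] at h1
    rw [add_comm (((p : ℝ) ^ (5 * ℓ + 17 * q))⁻¹)]
    exact le_trans (by exact_mod_cast hle) h1
  · intro x y z h hsum
    simp only [configurations, Finset.mem_filter, Finset.mem_univ, true_and, mem_atom,
      mem_bilinearLevelSet] at h
    obtain ⟨⟨hx, hy, hz⟩, hxy, hxz, hyz⟩ := h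
    have hyx := fun i k j => (𝓑.dotProduct_mulVec_comm j (y i) (x k)).trans (hxy k i j)
    have hxx := fun j => 𝓑.dotProduct_mulVec_comm j (x 0) (x 1)
    have hyy := fun j => 𝓑.dotProduct_mulVec_comm j (y 0) (y 1)
    simp only [Finset.mem_filter, Finset.mem_univ, true_and]
    refine ⟨?_, ?_⟩
    · rintro ⟨⟨⟨s, t⟩, hst⟩, j⟩
      fin_cases s <;> fin_cases t <;> first
        | exact absurd hst (by decide)
        | (simp [e, L, u, U, hx, hy, hz, hxy, hxz, hyz, hyx, hxx, hyy, ← hsum,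
            Matrix.mulVec_add, dotProduct_add]; done)
        | (simp [e, L, u, U, hxy, hxz, hyz, hyx, hxx, hyy, ← hsum,
            Matrix.mulVec_add, dotProduct_add]; ring)
    · rintro (⟨s, i⟩ | j | j)
      · fin_cases s <;> simp [R, σ, t, hx, hy, hz]
      · simp [R, σ, t, hx, hxy, hxz, ← hsum, Matrix.mulVec_add, dotProduct_add]
      · simp [R, σ, t, hy, hyx, hyz, ← hsum, Matrix.mulVec_add, dotProduct_add]

/-! ### Bounding the inner product by sums of `|f|` -/

theorem norm_iterate_starRingEnd (k : ℕ) (z : ℂ) : ‖(starRingEnd ℂ)^[k] z‖ = ‖z‖ := by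
  induction k with
  | zero => rfl
  | succ k ih => rw [Function.iterate_succ_apply', RCLike.norm_conj, ih]

/-- Seven of the eight factors are bounded by 1 and only `ω = 0` is kept. On a configuration each of
the three measures contributes its constant value four times; elsewhere some measure vanishes. -/
theorem norm_localU3Inner_le (𝓑 : QuadraticFactor p n ℓ q) (d : TripleLabel p ℓ q)
    (f : (Fin n → ZMod p) → ℂ) (hf : ∀ x, ‖f x‖ ≤ 1) :
    ‖𝓑.localU3Inner d fun _ => f‖ ≤
      (((((p : ℝ) ^ n) ^ 2 / (𝓑.bilinearLevelSet d.b₁₂).card) ^ 4 *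
        (((p : ℝ) ^ n) ^ 2 / (𝓑.bilinearLevelSet d.b₁₃).card) ^ 4 *
        (((p : ℝ) ^ n) ^ 2 / (𝓑.bilinearLevelSet d.b₂₃).card) ^ 4) *
      ∑ v ∈ 𝓑.configurations d, ‖f (v.1 0 + v.2.1 0 + v.2.2 0)‖) /
      ((𝓑.atom d.a₁).card ^ 2 * (𝓑.atom d.a₂).card ^ 2 * (𝓑.atom d.a₃).card ^ 2) := by
  classical
  have hV : (Fintype.card (Fin n → ZMod p) : ℝ) = (p : ℝ) ^ n := by simp [ZMod.card]
  set K : ℝ := (((p : ℝ) ^ n) ^ 2 / (𝓑.bilinearLevelSet d.b₁₂).card) ^ 4 *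
        (((p : ℝ) ^ n) ^ 2 / (𝓑.bilinearLevelSet d.b₁₃).card) ^ 4 *
        (((p : ℝ) ^ n) ^ 2 / (𝓑.bilinearLevelSet d.b₂₃).card) ^ 4 with hK
  have hprod : ∀ g : (Fin 3 → Fin 2) → ℂ, (∀ ω, ‖g ω‖ ≤ 1) → ‖∏ ω, g ω‖ ≤ ‖g 0‖ := by
    intro g hg
    rw [norm_prod, ← Finset.mul_prod_erase _ _ (Finset.mem_univ 0)]
    exact mul_le_of_le_one_right (norm_nonneg _)
      (Finset.prod_le_one (fun _ _ => norm_nonneg _) fun ω _ => hg ω)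
  have hterm : ∀ x ∈ Fintype.piFinset (fun _ : Fin 2 => 𝓑.atom d.a₁),
      ∀ y ∈ Fintype.piFinset (fun _ : Fin 2 => 𝓑.atom d.a₂),
      ∀ z ∈ Fintype.piFinset (fun _ : Fin 2 => 𝓑.atom d.a₃),
      ‖(∏ i, ∏ j, (charMeasure (𝓑.bilinearLevelSet d.b₁₂) (x i) (y j) : ℂ)) *
        (∏ i, ∏ k, (charMeasure (𝓑.bilinearLevelSet d.b₁₃) (x i) (z k) : ℂ)) *
        (∏ j, ∏ k, (charMeasure (𝓑.bilinearLevelSet d.b₂₃) (y j) (z k) : ℂ)) *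
        ∏ ω : Fin 3 → Fin 2,
          (starRingEnd ℂ)^[∑ i, (ω i : ℕ)] (f (x (ω 0) + y (ω 1) + z (ω 2)))‖ ≤
      if (x, y, z) ∈ 𝓑.configurations d then K * ‖f (x 0 + y 0 + z 0)‖ else 0 := by
    intro x hx y hy z hz
    rw [Fintype.mem_piFinset] at hx hy hz
    split_ifs with h
    · simp only [configurations, Finset.mem_filter, Finset.mem_univ, true_and] at h
      obtain ⟨-, hxy, hxz, hyz⟩ := h
      rw [norm_mul]
      refine mul_le_mul (le_of_eq ?_) ((hprod _ fun ω => ?_).trans (le_of_eq ?_))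
        (norm_nonneg _) (by positivity)
      · simp only [charMeasure, hxy, hxz, hyz, if_true, hV, hK]
        simp only [Finset.prod_const, Finset.card_univ, Fintype.card_fin, norm_mul, norm_pow,
          Complex.norm_real, norm_div, Real.norm_natCast, ← pow_mul]
      · rw [norm_iterate_starRingEnd]; exact hf _
      · rw [norm_iterate_starRingEnd]; rfl
    · refine le_of_eq (norm_eq_zero.2 ?_)
      have hzero : ∀ (b : Fin q → ZMod p) (u v : Fin 2 → Fin n → ZMod p),
          (∃ i j, (u i, v j) ∉ 𝓑.bilinearLevelSet b) →
          ∏ i, ∏ j, (charMeasure (𝓑.bilinearLevelSet b) (u i) (v j) : ℂ) = 0 := by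
        rintro b u v ⟨i, j, hij⟩
        refine Finset.prod_eq_zero (Finset.mem_univ i)
          (Finset.prod_eq_zero (Finset.mem_univ j) ?_)
        simp [charMeasure, hij]
      by_cases h1 : ∃ i j, (x i, y j) ∉ 𝓑.bilinearLevelSet d.b₁₂
      · rw [hzero _ _ _ h1]; ring
      by_cases h2 : ∃ i j, (x i, z j) ∉ 𝓑.bilinearLevelSet d.b₁₃
      · rw [hzero _ _ _ h2]; ring
      by_cases h3 : ∃ i j, (y i, z j) ∉ 𝓑.bilinearLevelSet d.b₂₃
      · rw [hzero _ _ _ h3]; ring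
      push Not at h1 h2 h3
      exact absurd (by simp [configurations, hx, hy, hz, h1, h2, h3]) h
  unfold localU3Inner
  simp only [Finset.expect_eq_sum_div_card, ← Finset.sum_div, norm_div, div_div]
  refine (div_le_div_of_nonneg_right
    (b := K * ∑ v ∈ 𝓑.configurations d, ‖f (v.1 0 + v.2.1 0 + v.2.2 0)‖) ?_
    (norm_nonneg _)).trans (le_of_eq ?_)
  · refine (norm_sum_le_of_le _ fun x hx => norm_sum_le_of_le _ fun y hy =>
      norm_sum_le_of_le _ fun z hz => hterm x hx y hy z hz).trans ?_
    rw [Finset.mul_sum]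
    simp only [← Finset.sum_product']
    refine (Finset.sum_ite_mem _ (𝓑.configurations d)
      fun v => K * ‖f (v.1 0 + v.2.1 0 + v.2.2 0)‖).le.trans ?_
    exact Finset.sum_le_sum_of_subset_of_nonneg Finset.inter_subset_right
      fun _ _ _ => by positivity
  · congr 1
    simp only [Fintype.card_piFinset_const, norm_mul, norm_pow, Complex.norm_natCast,
      Nat.cast_pow]
    ring

theorem sum_norm_indicator_sub_density_le {V : Type*} [DecidableEq V]
    (A S : Finset V) :
    ∑ w ∈ S, ‖(if w ∈ A then 1 else 0 : ℂ) - (density A S : ℂ)‖ ≤ 2 * (density A S * S.card) := by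
  have h0 : 0 ≤ density A S := by unfold density; positivity
  have hcard : ((A ∩ S).card : ℝ) = density A S * S.card := by
    unfold density
    rcases S.eq_empty_or_nonempty with h | h
    · simp [h]
    · have : (0 : ℝ) < S.card := by exact_mod_cast h.card_pos
      field_simp
  calc ∑ w ∈ S, ‖(if w ∈ A then 1 else 0 : ℂ) - (density A S : ℂ)‖
      ≤ ∑ w ∈ S, ((if w ∈ A then 1 else 0) + density A S) := by
        refine Finset.sum_le_sum fun w _ => (norm_sub_le _ _).trans (le_of_eq ?_)
        rw [Complex.norm_real, Real.norm_of_nonneg h0]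
        split_ifs <;> simp
    _ = 2 * (density A S * S.card) := by
        rw [Finset.sum_add_distrib, Finset.sum_boole, Finset.filter_mem_eq_inter,
          Finset.inter_comm, hcard, Finset.sum_const, nsmul_eq_mul]
        ring

theorem norm_indicator_sub_density_le_one {V : Type*} [DecidableEq V] (A S : Finset V) (w : V) :
    ‖(if w ∈ A then 1 else 0 : ℂ) - (density A S : ℂ)‖ ≤ 1 := by
  have h0 : 0 ≤ density A S := by unfold density; positivity
  have h1 : density A S ≤ 1 :=
    div_le_one_of_le₀ (by exact_mod_cast Finset.card_le_card Finset.inter_subset_right)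
      (by positivity)
  have : (if w ∈ A then 1 else 0 : ℂ) - (density A S : ℂ) =
      (((if w ∈ A then 1 else 0) - density A S : ℝ) : ℂ) := by
    split_ifs <;> simp
  rw [this, Complex.norm_real, Real.norm_eq_abs, abs_le]
  split_ifs <;> constructor <;> linarith

/-- Group the configurations by `w = x₀ + y₀ + z₀`. The first term comes from generic `w`, whose
fibre is empty outside the atom `Σ(d)`; the second is the number of non-generic `w` times the
trivial fibre bound. -/
theorem sum_configurations_le (hp : 2 < p) (𝓑 : QuadraticFactor p n ℓ q)
    {m : ℕ} (hm : ∀ c : Fin q → ZMod p, c ≠ 0 → 2 * m ≤ (∑ j, c j • 𝓑.M j).rank)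
    (d : TripleLabel p ℓ q) (g : (Fin n → ZMod p) → ℝ) (hg0 : ∀ w, 0 ≤ g w) (hg1 : ∀ w, g w ≤ 1) :
    ∑ v ∈ 𝓑.configurations d, g (v.1 0 + v.2.1 0 + v.2.2 0) ≤
      (((p : ℝ) ^ (5 * ℓ + 17 * q))⁻¹ + ((p : ℝ) ^ m)⁻¹) * ((p : ℝ) ^ n) ^ 5 *
        ∑ w ∈ 𝓑.atom d.sigma, g w +
      (p : ℝ) ^ (q + ℓ) / (p : ℝ) ^ (2 * m) * ((p : ℝ) ^ n) ^ 6 := by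
  classical
  have hp0 : (0 : ℝ) < p := by exact_mod_cast (Fact.out : p.Prime).pos
  set N : ℝ := (((p : ℝ) ^ (5 * ℓ + 17 * q))⁻¹ + ((p : ℝ) ^ m)⁻¹) * ((p : ℝ) ^ n) ^ 5 with hN
  set bad := Finset.univ.filter fun w => ¬ 𝓑.IsGeneric w with hbad
  set fib : (Fin n → ZMod p) → Finset _ := fun w =>
    (𝓑.configurations d).filter fun v => v.1 0 + v.2.1 0 + v.2.2 0 = w with hfib
  have hfibw : ∀ w, ((fib w).card : ℝ) * g w ≤
      (if w ∈ 𝓑.atom d.sigma then N * g w else 0) +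
        if w ∈ bad then ((p : ℝ) ^ n) ^ 5 else 0 := by
    intro w
    have hNg : 0 ≤ N * g w := mul_nonneg (by positivity) (hg0 w)
    by_cases hw : w ∈ bad
    · rw [if_pos hw]
      have h1 : ((fib w).card : ℝ) ≤ ((p : ℝ) ^ n) ^ 5 := by
        exact_mod_cast 𝓑.card_configurations_fiber_le_pow d w
      have h2 : ((fib w).card : ℝ) * g w ≤ ((p : ℝ) ^ n) ^ 5 * 1 :=
        mul_le_mul h1 (hg1 w) (hg0 w) (by positivity)
      split_ifs <;> linarith
    · rw [if_neg hw, add_zero]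
      have hgen : 𝓑.IsGeneric w := by simpa [hbad] using hw
      split_ifs with hw'
      · exact mul_le_mul_of_nonneg_right
          (𝓑.card_configurations_fiber_le_of_isGeneric hp hm d hgen) (hg0 w)
      · have : fib w = ∅ := by
          refine Finset.filter_eq_empty_iff.2 fun v hv hvw => hw' ?_
          simp only [configurations, Finset.mem_filter, Finset.mem_univ, true_and] at hv
          obtain ⟨⟨hx, hy, hz⟩, hxy, hxz, hyz⟩ := hv
          rw [← hvw]
          exact 𝓑.add_add_mem_atom_sigma d (hx 0) (hy 0) (hz 0) (hxy 0 0) (hxz 0 0) (hyz 0 0)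
        simp [this]
  have hbadcard : (bad.card : ℝ) ≤ (p : ℝ) ^ (q + ℓ) / (p : ℝ) ^ (2 * m) * (p : ℝ) ^ n := by
    rw [div_mul_eq_mul_div, le_div_iff₀ (by positivity)]
    exact_mod_cast 𝓑.card_not_isGeneric_mul_le hm
  calc ∑ v ∈ 𝓑.configurations d, g (v.1 0 + v.2.1 0 + v.2.2 0)
      = ∑ w, ∑ v ∈ fib w, g (v.1 0 + v.2.1 0 + v.2.2 0) :=
        (Finset.sum_fiberwise _ _ _).symm
    _ = ∑ w, (fib w).card * g w := by
        refine Finset.sum_congr rfl fun w _ => ?_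
        rw [← nsmul_eq_mul, ← Finset.sum_const]
        exact Finset.sum_congr rfl fun v hv => by rw [(Finset.mem_filter.1 hv).2]
    _ ≤ ∑ w, ((if w ∈ 𝓑.atom d.sigma then N * g w else 0) +
        if w ∈ bad then ((p : ℝ) ^ n) ^ 5 else 0) := Finset.sum_le_sum fun w _ => hfibw w
    _ = N * ∑ w ∈ 𝓑.atom d.sigma, g w + bad.card * ((p : ℝ) ^ n) ^ 5 := by
        rw [Finset.sum_add_distrib, Finset.sum_ite_mem, Finset.sum_ite_mem, Finset.univ_inter,
          Finset.univ_inter, Finset.mul_sum, Finset.sum_const, nsmul_eq_mul]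
    _ ≤ N * ∑ w ∈ 𝓑.atom d.sigma, g w +
        ((p : ℝ) ^ (q + ℓ) / (p : ℝ) ^ (2 * m) * (p : ℝ) ^ n) * ((p : ℝ) ^ n) ^ 5 := by gcongr
    _ = _ := by ring

/-! ### Numerical estimates and conclusion -/

/-- The numerical estimate behind the bound on the inner product: `P`, `x`, `y` stand for `p ^ n`,
`p ^ ℓ`, `p ^ q`, the `Bᵢ` and `βᵢ` for the sizes of the atoms and bilinear level sets. -/
theorem weighted_sum_le {P x y κ ε B₁ B₂ B₃ B β₁ β₂ β₃ s t : ℝ} (hP : 0 < P) (hx : 0 < x)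
    (hy : 0 < y) (hκ : 0 ≤ κ) (hκ' : κ ≤ 1 / 10) (hκε : κ ≤ ε)
    (hB₁ : (1 - κ) * (P / (x * y)) ≤ B₁) (hB₂ : (1 - κ) * (P / (x * y)) ≤ B₂)
    (hB₃ : (1 - κ) * (P / (x * y)) ≤ B₃) (hB : B ≤ (1 + κ) * (P / (x * y)))
    (hβ₁ : (1 - κ) * (P ^ 2 / y) ≤ β₁) (hβ₂ : (1 - κ) * (P ^ 2 / y) ≤ β₂)
    (hβ₃ : (1 - κ) * (P ^ 2 / y) ≤ β₃) (hs : s ≤ 2 * (ε * B))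
    (ht : t ≤ (1 + κ) / (x ^ 5 * y ^ 17) * P ^ 5 * s + κ / (x ^ 6 * y ^ 18) * P ^ 6) :
    ((P ^ 2 / β₁) ^ 4 * (P ^ 2 / β₂) ^ 4 * (P ^ 2 / β₃) ^ 4 * t) /
      (B₁ ^ 2 * B₂ ^ 2 * B₃ ^ 2) ≤ 256 * ε := by
  have hε : 0 ≤ ε := hκ.trans hκε
  have h1κ : 9 / 10 ≤ 1 - κ := by linarith
  have hquot : ∀ β, (1 - κ) * (P ^ 2 / y) ≤ β → 0 < β ∧ P ^ 2 / β ≤ 10 / 9 * y := by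
    intro β hβ
    have h1 : 9 / 10 * (P ^ 2 / y) ≤ β :=
      (mul_le_mul_of_nonneg_right h1κ (by positivity)).trans hβ
    have hβ0 : 0 < β := lt_of_lt_of_le (by positivity) h1
    refine ⟨hβ0, ?_⟩
    rw [div_le_iff₀ hβ0]
    calc P ^ 2 = 10 / 9 * y * (9 / 10 * (P ^ 2 / y)) := by field_simp
      _ ≤ _ := by gcongr
  have hquot' : ∀ C, (1 - κ) * (P / (x * y)) ≤ C → 9 / 10 * (P / (x * y)) ≤ C := fun C hC =>
    (mul_le_mul_of_nonneg_right h1κ (by positivity)).trans hC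
  have ht' : t ≤ 4 * ε * (P ^ 6 / (x ^ 6 * y ^ 18)) := by
    have h1 : s ≤ 2 * (ε * ((1 + κ) * (P / (x * y)))) := hs.trans (by gcongr)
    have h2 : (1 + κ) ^ 2 ≤ 3 / 2 := by nlinarith
    calc t ≤ (1 + κ) / (x ^ 5 * y ^ 17) * P ^ 5 * (2 * (ε * ((1 + κ) * (P / (x * y))))) +
          κ / (x ^ 6 * y ^ 18) * P ^ 6 := ht.trans (by gcongr)
      _ = (2 * ε * (1 + κ) ^ 2 + κ) * (P ^ 6 / (x ^ 6 * y ^ 18)) := by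
          field_simp
      _ ≤ _ := by
          refine mul_le_mul_of_nonneg_right ?_ (by positivity)
          nlinarith
  obtain ⟨p₁, q₁⟩ := hquot _ hβ₁
  obtain ⟨p₂, q₂⟩ := hquot _ hβ₂
  obtain ⟨p₃, q₃⟩ := hquot _ hβ₃
  have c₁ := hquot' _ hB₁
  have c₂ := hquot' _ hB₂
  have c₃ := hquot' _ hB₃
  calc _ ≤ ((P ^ 2 / β₁) ^ 4 * (P ^ 2 / β₂) ^ 4 * (P ^ 2 / β₃) ^ 4 *
        (4 * ε * (P ^ 6 / (x ^ 6 * y ^ 18)))) / (B₁ ^ 2 * B₂ ^ 2 * B₃ ^ 2) := by gcongr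
    _ ≤ ((10 / 9 * y) ^ 4 * (10 / 9 * y) ^ 4 * (10 / 9 * y) ^ 4 *
        (4 * ε * (P ^ 6 / (x ^ 6 * y ^ 18)))) /
        ((9 / 10 * (P / (x * y))) ^ 2 * (9 / 10 * (P / (x * y))) ^ 2 *
          (9 / 10 * (P / (x * y))) ^ 2) := by gcongr
    -- Twelve factors `10 / 9` come from the measures and six from the atoms; the product is below
    -- `27 * ε`.
    _ = 4 * (10 / 9) ^ 18 * ε := by field_simp
    _ ≤ 256 * ε := by
        refine mul_le_mul_of_nonneg_right ?_ hε
        norm_num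

/-- The smallest main term to be compared with an error is `p^-(6ℓ + 18q)`, from all the conditions
on six points. Taking `m = 18(ℓ + q) + N` makes every error at most `κ = p^-N` times the
corresponding main term. -/
theorem norm_localU3Inner_indicator_sub_density_le (hp : 2 < p) (𝓑 : QuadraticFactor p n ℓ q)
    {ε : ℝ} {N : ℕ} (hN : ((p : ℝ) ^ N)⁻¹ ≤ 1 / 10) (hNε : ((p : ℝ) ^ N)⁻¹ ≤ ε)
    (hm : ∀ c : Fin q → ZMod p, c ≠ 0 →
      2 * (18 * (ℓ + q) + N) ≤ (∑ j, c j • 𝓑.M j).rank)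
    (d : TripleLabel p ℓ q) (A : Finset (Fin n → ZMod p))
    (hA : density A (𝓑.atom d.sigma) ≤ ε) :
    ‖𝓑.localU3Inner d fun _ x => (if x ∈ A then 1 else 0) -
      (density A (𝓑.atom d.sigma) : ℂ)‖ ≤ 256 * ε := by
  set m := 18 * (ℓ + q) + N with hmdef
  set κ : ℝ := ((p : ℝ) ^ N)⁻¹ with hκ
  have hp1 : (1 : ℝ) ≤ p := by exact_mod_cast (Fact.out : p.Prime).one_le
  have hp0 : (0 : ℝ) < p := by linarith
  have hκ0 : 0 < κ := by positivity
  have hP : 0 < (p : ℝ) ^ n := by positivity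
  have hx : 0 < (p : ℝ) ^ ℓ := by positivity
  have hy : 0 < (p : ℝ) ^ q := by positivity
  have hε : 0 ≤ ε := hκ0.le.trans hNε
  have herr : ∀ k, k ≤ 18 * (ℓ + q) → ((p : ℝ) ^ m)⁻¹ ≤ κ * ((p : ℝ) ^ k)⁻¹ := by
    intro k hk
    rw [hκ, ← mul_inv, ← pow_add]
    exact inv_anti₀ (by positivity) (pow_le_pow_right₀ hp1 (by omega))
  have hatom : ∀ a, (1 - κ) * ((p : ℝ) ^ n / ((p : ℝ) ^ ℓ * (p : ℝ) ^ q)) ≤ (𝓑.atom a).card ∧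
      (𝓑.atom a).card ≤ (1 + κ) * ((p : ℝ) ^ n / ((p : ℝ) ^ ℓ * (p : ℝ) ^ q)) := by
    intro a
    have h1 := abs_le.1 ((𝓑.abs_density_atom_sub_le hp hm a).trans (herr (q + ℓ) (by omega)))
    have h2 : (p : ℝ) ^ n / ((p : ℝ) ^ ℓ * (p : ℝ) ^ q) = ((p : ℝ) ^ (q + ℓ))⁻¹ * (p : ℝ) ^ n := by
      rw [pow_add]; field_simp
    rw [h2, ← mul_assoc, ← mul_assoc, ← le_div_iff₀ hP, ← div_le_iff₀ hP]
    constructor <;> linarith [h1.1, h1.2]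
  have hbil : ∀ b, (1 - κ) * (((p : ℝ) ^ n) ^ 2 / (p : ℝ) ^ q) ≤ (𝓑.bilinearLevelSet b).card := by
    intro b
    have h1 := abs_le.1 ((𝓑.abs_density_bilinearLevelSet_sub_le hp hm b).trans
      (herr q (by omega)))
    rw [div_eq_inv_mul, ← mul_assoc, ← le_div_iff₀ (by positivity)]
    linarith [h1.1]
  set f : (Fin n → ZMod p) → ℂ := fun x => (if x ∈ A then 1 else 0) -
      (density A (𝓑.atom d.sigma) : ℂ) with hf
  have hf1 : ∀ x, ‖f x‖ ≤ 1 := norm_indicator_sub_density_le_one A _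
  have hsum := 𝓑.sum_configurations_le hp hm d (fun w => ‖f w‖) (fun _ => norm_nonneg _) hf1
  refine (𝓑.norm_localU3Inner_le d f hf1).trans ?_
  refine weighted_sum_le hP hx hy hκ0.le hN hNε (hatom _).1 (hatom _).1 (hatom _).1
    (hatom d.sigma).2 (hbil _) (hbil _) (hbil _)
    (s := ∑ w ∈ 𝓑.atom d.sigma, ‖f w‖) ?_ (hsum.trans ?_)
  · refine (sum_norm_indicator_sub_density_le A _).trans ?_
    gcongr
  · have h1 : ((p : ℝ) ^ (5 * ℓ + 17 * q))⁻¹ + ((p : ℝ) ^ m)⁻¹ ≤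
        (1 + κ) / (((p : ℝ) ^ ℓ) ^ 5 * ((p : ℝ) ^ q) ^ 17) := by
      have h2 := herr (5 * ℓ + 17 * q) (by omega)
      rw [← pow_mul, ← pow_mul, ← pow_add, mul_comm ℓ, mul_comm q, div_eq_mul_inv]
      linarith
    have h3 : (p : ℝ) ^ (q + ℓ) / (p : ℝ) ^ (2 * m) ≤
        κ / (((p : ℝ) ^ ℓ) ^ 6 * ((p : ℝ) ^ q) ^ 18) := by
      rw [← pow_mul, ← pow_mul, ← pow_add, hκ, div_le_div_iff₀ (by positivity) (by positivity),
        ← pow_add, inv_mul_eq_div, le_div_iff₀ (by positivity), ← pow_add]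
      exact pow_le_pow_right₀ hp1 (by omega)
    gcongr

end QuadraticFactor
end QuadFourier

theorem mainTheorem6 (p : ℕ) [Fact p.Prime] (hp : 2 < p) (ε : ℝ) (hε : 0 < ε) :
    ∃ ρ₀ : ℝ → ℝ, QuadFourier.IsGrowthFunction ρ₀ ∧
      ∀ ρ : ℝ → ℝ, QuadFourier.IsGrowthFunction ρ → (∀ x, 0 < x → ρ₀ x ≤ ρ x) →
        ∀ (n ℓ q : ℕ) (𝓑 : QuadFourier.QuadraticFactor p n ℓ q),
          ENNReal.ofReal (ρ ((ℓ : ℝ) + (q : ℝ))) ≤ (𝓑.rank : ℝ≥0∞) →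
          ∀ (d : QuadFourier.TripleLabel p ℓ q) (A : Finset (Fin n → ZMod p)),
            QuadFourier.density A (𝓑.atom d.sigma) ≤ ε →
            𝓑.localU3Norm d
              (fun x => (if x ∈ A then 1 else 0) -
                (QuadFourier.density A (𝓑.atom d.sigma) : ℂ)) ≤ 2 * ε ^ (1 / 8 : ℝ) := by
  have hp1 : (1 : ℝ) < p := by exact_mod_cast (Fact.out : p.Prime).one_lt
  obtain ⟨N, hN⟩ := exists_pow_lt_of_lt_one (lt_min hε (by norm_num : (0 : ℝ) < 1 / 10))
    (inv_lt_one_of_one_lt₀ hp1)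
  rw [inv_pow] at hN
  refine ⟨fun x => 2 * (18 * x + N), ⟨fun x hx => by positivity, fun x _ y _ hxy => ?_⟩, ?_⟩
  · simp only
    gcongr
  intro ρ _ hρ n ℓ q 𝓑 hrank d A hA
  have hm : ∀ c : Fin q → ZMod p, c ≠ 0 →
      2 * (18 * (ℓ + q) + N) ≤ (∑ j, c j • 𝓑.M j).rank := by
    intro c hc
    -- A nonzero `c` forces `q > 0`, so `ℓ + q` is a positive argument, where `ρ₀ ≤ ρ` is available.
    have hq : 0 < q := by
      rcases Nat.eq_zero_or_pos q with rfl | h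
      · exact absurd (Subsingleton.elim c 0) hc
      · exact h
    have h1 : 𝓑.rank ≤ ((∑ j, c j • 𝓑.M j).rank : ℕ∞) := iInf₂_le c hc
    have h2 : ((2 * (18 * (ℓ + q) + N) : ℕ) : ℝ) ≤ ρ ((ℓ : ℝ) + (q : ℝ)) := by
      push_cast
      exact hρ _ (by positivity)
    have h3 : ((2 * (18 * (ℓ + q) + N) : ℕ) : ℝ≥0∞) ≤ ((∑ j, c j • 𝓑.M j).rank : ℕ) := by
      calc ((2 * (18 * (ℓ + q) + N) : ℕ) : ℝ≥0∞)
          = ENNReal.ofReal ((2 * (18 * (ℓ + q) + N) : ℕ) : ℝ) := (ENNReal.ofReal_natCast _).symm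
        _ ≤ (𝓑.rank : ℝ≥0∞) := (ENNReal.ofReal_le_ofReal h2).trans hrank
        _ ≤ _ := by
            rw [← ENat.toENNReal_coe]
            exact ENat.toENNReal_le.2 h1
    exact_mod_cast h3
  have hinner := 𝓑.norm_localU3Inner_indicator_sub_density_le hp
    (hN.le.trans (min_le_right _ _)) (hN.le.trans (min_le_left _ _)) hm d A hA
  calc 𝓑.localU3Norm d _ ≤ (256 * ε) ^ (1 / 8 : ℝ) :=
        Real.rpow_le_rpow (norm_nonneg _) hinner (by norm_num)
    _ = 2 * ε ^ (1 / 8 : ℝ) := by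
        rw [Real.mul_rpow (by norm_num) hε.le, show (256 : ℝ) = 2 ^ (8 : ℝ) by norm_num,
          ← Real.rpow_mul (by norm_num)]
        norm_num
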